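/- Setting. Let $\mathcal Y$ be a measurable space, $\Theta$ a metric space with distance $d$ (for instance $\Theta\subseteq\mathbb R^p$) equipped with a $\sigma$-algebra containing its open sets, $\{\mu_\theta:\theta\in\Theta\}$ a statistical model of probability measures on $\mathcal Y$ (depending measurably on $\theta$), $\pi$ a prior probability measure on $\Theta$, and $\mu^*$ a probability measure on $\mathcal Y$. Let $\mathfrak F$ be a class of measurable functions $f:\mathcal Y\to\mathbb R$ and $$\mathcal D_{\mathfrak F}(\mu_1,\mu_2)=\sup_{f\in\mathfrak F}\Bigl|\int f\,d\mu_1-\int f\,d\mu_2\Bigr|,\qquad \varepsilon^*=\inf_{\theta\in\Theta}\mathcal D_{\mathfrak F}(\mu_\theta,\mu^*),$$ $$\mathfrak R_n(\mathfrak F)=\sup_{\mu}\ \mathbb E\Bigl[\sup_{f\in\mathfrak F}\Bigl|\frac1n\sum_{i=1}^n\epsilon_i f(x_i)\Bigr|\Bigr],$$ where the outer supremum is over all probability measures $\mu$ on $\mathcal Y$, $x_1,\dots,x_n$ are i.i.d. from $\mu$, and $\epsilon_1,\dots,\epsilon_n$ are independent of them and i.i.d. with $\mathbb P(\epsilon_i=1)=\mathbb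 P(\epsilon_i=-1)=1/2$. The suprema over $\mathfrak F$ of empirical quantities, namely $(z_{1:n},y_{1:n})\mapsto\mathcal D_{\mathfrak F}(\hat\mu_{z_{1:n}},\hat\mu_{y_{1:n}})$ and, for all signs $e_i\in\{-1,1\}$, $x_{1:n}\mapsto\sup_{f\in\mathfrak F}|\frac1n\sum_i e_if(x_i)|$, are assumed to be measurable; here $\hat\mu_{x_{1:n}}=\frac1n\sum_{i=1}^n\delta_{x_i}$. Given data $y_{1:n}\in\mathcal Y^n$ and a threshold $\varepsilon\ge0$, the ABC posterior is, whenever the acceptance probability in the denominator is positive, $$\pi_n^{(\varepsilon)}(A)=\frac{\int_A \mu_\theta^n\{z_{1:n}:\mathcal D_{\mathfrak F}(\hat\mu_{z_{1:n}},\hat\mu_{y_{1:n}})\le\varepsilon\}\,\pi(d\theta)}{\int_\Theta \mu_\theta^n\{z_{1:n}:\mathcal D_{\mathfrak F}(\hat\mu_{z_{1:n}},\hat\mu_{y_{1:n}})\le\varepsilon\}\,\pi(d\theta)}.$$ Assumptions. (I) For every $n$ the observed data $y_{1:n}$ are i.i.d. from $\mu^*$. (II) $L>0$ and $c_\pi>0$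 are such that $\pi(\{\theta:\mathcal D_{\mathfrak F}(\mu_\theta,\mu^*)\le\varepsilon^*+\bar\varepsilon\})\ge c_\pi\bar\varepsilon^L$ for all sufficiently small $\bar\varepsilon>0$. (III) $b>0$ is such that $|f(y)|\le b$ for all $f\in\mathfrak F$ and $y\in\mathcal Y$. (IV) $\mathfrak R_n(\mathfrak F)\to0$ as $n\to\infty$. (V) $\theta^*\in\Theta$ minimizes $\theta\mapsto\mathcal D_{\mathfrak F}(\mu_\theta,\mu^*)$ and is well separated: for every $\delta>0$ there is $\delta'>0$ with $\inf_{\theta:\,d(\theta,\theta^*)>\delta}\mathcal D_{\mathfrak F}(\mu_\theta,\mu^*)>\mathcal D_{\mathfrak F}(\mu_{\theta^*},\mu^*)+\delta'$ (with $\inf\emptyset=\infty$). (VI) The parameters are identifiable ($\theta\ne\theta'$ implies $\mu_\theta\ne\mu_{\theta'}$), and $K>0$, $\nu>0$ and an open neighborhood $U$ of $\theta^*$ in $\Theta$ are such that $d(\theta,\theta^*)\le K[\mathcal D_{\mathfrak F}(\mu_\theta,\mu^*)-\varepsilon^*]^\nu$ for all $\theta\in U$. Statement. Assume (I)-(VI),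 and let $\bar\varepsilon_n\to0$ with $n\bar\varepsilon_n^2\to\infty$ and $\bar\varepsilon_n/\mathfrak R_n(\mathfrak F)\to\infty$ as $n\to\infty$ (where $a/0=\infty$ for $a>0$). Then, with $\mathbb P_{y_{1:n}}$-probability tending to $1$ as $n\to\infty$, the ABC posterior with threshold $\varepsilon^*+\bar\varepsilon_n$ is well defined and satisfies $$\pi_n^{(\varepsilon^*+\bar\varepsilon_n)}\Bigl(\Bigl\{\theta: d(\theta,\theta^*)>K\Bigl[\frac{4\bar\varepsilon_n}{3}+2\mathfrak R_n(\mathfrak F)+\Bigl[\frac{2b^2}{n}\log\frac{n}{\bar\varepsilon_n^L}\Bigr]^{1/2}\Bigr]^\nu\Bigr\}\Bigr)\le\frac{2\cdot3^L}{c_\pi\,n}.$$ -/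

import Mathlib

open MeasureTheory ProbabilityTheory Filter Topology
open scoped ENNReal

noncomputable section

namespace ABC

/-- The integral probability semimetric
`D_F(μ₁, μ₂) = sup_{f ∈ F} |∫ f dμ₁ - ∫ f dμ₂|`, with values in `[0, ∞]`. -/
def ips {Y : Type*} [MeasurableSpace Y] (F : Set (Y → ℝ)) (μ₁ μ₂ : Measure Y) : ℝ≥0∞ :=
  ⨆ f ∈ F, ENNReal.ofReal |(∫ y, f y ∂μ₁) - ∫ y, f y ∂μ₂|

/-- The law `μ^n` of an i.i.d. sample of size `n` from `μ`. -/
def sampleLaw {Y : Type*} [MeasurableSpace Y] (μ : Measure Y) (n : ℕ) : Measure (Fin n → Y) :=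
  Measure.pi fun _ : Fin n => μ

/-- The empirical distribution `n⁻¹ ∑ i, δ_{x i}` of a sample. -/
def empirical {Y : Type*} [MeasurableSpace Y] {n : ℕ} (x : Fin n → Y) : Measure Y :=
  (n : ℝ≥0∞)⁻¹ • ∑ i, Measure.dirac (x i)

/-- `sup_{f ∈ F} |n⁻¹ ∑ i, e i * f (x i)|`, for a vector `e` of signs and a sample `x`. -/
def signedSup {Y : Type*} (F : Set (Y → ℝ)) {n : ℕ} (e : Fin n → ℤˣ) (x : Fin n → Y) : ℝ≥0∞ :=
  ⨆ f ∈ F, ENNReal.ofReal |(1 / (n : ℝ)) * ∑ i, ((e i : ℤ) : ℝ) * f (x i)|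

/-- The Rademacher complexity `E [sup_{f ∈ F} |n⁻¹ ∑ i, ε i * f (x i)|]`, where `x` is an i.i.d.
sample from `μ` and, independently, `ε 1, …, ε n` are i.i.d. uniform signs: the vector of signs is
uniform on the `2 ^ n` elements of `{-1, 1}^n` (`ℤˣ` is `{-1, 1}`). -/
def rademacher {Y : Type*} [MeasurableSpace Y] (F : Set (Y → ℝ)) (μ : Measure Y) (n : ℕ) : ℝ≥0∞ :=
  ((2 : ℝ≥0∞) ^ n)⁻¹ * ∑ e : Fin n → ℤˣ, ∫⁻ x, signedSup F e x ∂(sampleLaw μ n)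

/-- The worst-case Rademacher complexity `R_n(F) = sup_μ R_{μ,n}(F)`, over all probability
measures `μ` on `Y`. -/
def supRademacher {Y : Type*} [MeasurableSpace Y] (F : Set (Y → ℝ)) (n : ℕ) : ℝ≥0∞ :=
  ⨆ μ : ProbabilityMeasure Y, rademacher F (μ : Measure Y) n

/-- The probability `μ_θ^n {z | D_F(empirical z, empirical y) ≤ ε}` that a synthetic sample from
`μ_θ`, of the same size as the observed sample `y`, is accepted. -/
def acceptProb {Θ Y : Type*} [MeasurableSpace Θ] [MeasurableSpace Y] (F : Set (Y → ℝ))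
    (model : Kernel Θ Y) (ε : ℝ≥0∞) {n : ℕ} (y : Fin n → Y) (θ : Θ) : ℝ≥0∞ :=
  sampleLaw (model θ) n {z | ips F (empirical z) (empirical y) ≤ ε}

/-- The overall acceptance probability `∫ acceptProb dπ`. -/
def acceptMass {Θ Y : Type*} [MeasurableSpace Θ] [MeasurableSpace Y] (F : Set (Y → ℝ))
    (model : Kernel Θ Y) (prior : Measure Θ) (ε : ℝ≥0∞) {n : ℕ} (y : Fin n → Y) : ℝ≥0∞ :=
  ∫⁻ θ, acceptProb F model ε y θ ∂prior

/-- The ABC posterior with threshold `ε` given the observed sample `y`: the measure with density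
proportional to `acceptProb` with respect to the prior.  It is a probability measure as soon as
`acceptMass ≠ 0`, and is not defined (here: the zero measure) otherwise. -/
def abcPosterior {Θ Y : Type*} [MeasurableSpace Θ] [MeasurableSpace Y] (F : Set (Y → ℝ))
    (model : Kernel Θ Y) (prior : Measure Θ) (ε : ℝ≥0∞) {n : ℕ} (y : Fin n → Y) : Measure Θ :=
  (acceptMass F model prior ε y)⁻¹ • prior.withDensity (acceptProb F model ε y)

/-- The lowest attainable discrepancy `ε* = inf_θ D_F(μ_θ, μ*)`. -/
def minDiscrepancy {Θ Y : Type*} [MeasurableSpace Θ] [MeasurableSpace Y] (F : Set (Y → ℝ))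
    (model : Kernel Θ Y) (μstar : Measure Y) : ℝ≥0∞ :=
  ⨅ θ, ips F (model θ) μstar

/-- The radius `4 ε̄ / 3 + 2 R_n(F) + [(2 b² / n) log (n / ε̄ ^ L)] ^ (1 / 2)`. -/
def radius {Y : Type*} [MeasurableSpace Y] (F : Set (Y → ℝ)) (b L εbar : ℝ) (n : ℕ) : ℝ :=
  4 * εbar / 3 + 2 * (supRademacher F n).toReal
    + Real.sqrt (2 * b ^ 2 / n * Real.log (n / εbar ^ L))

end ABC

end

/-! Write `ε* + ε̄` for the threshold and take `t = ε̄/3`. By symmetrization and Markov's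
inequality, an empirical measure is within `t` of its own law outside an event of probability at
most `2 R_n / t`, uniformly over the law; this tends to `0` since `ε̄ / R_n → ∞`. The rest works on
the event that the data satisfy this bound.

The denominator of the posterior is not small: if `D(μ_θ, μ*) ≤ ε* + t`, the triangle inequality
accepts a synthetic sample with probability at least `1/2`, so the prior mass condition gives at
least `cπ (ε̄/3)^L / 2` (`acceptMass_ge`). The numerator is small: if `D(μ_θ, μ*)` exceeds `ε*` by
more than the radius, a single function `f` witnesses the gap, and acceptance forces the sample mean
of `f` far from its expectation. Hoeffding's inequality bounds this by `ε̄^L / n` (`acceptProb_le`),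
and the powers of `ε̄` cancel in the quotient. Separation and local control turn excess discrepancy
into distance once the radius is small (`dist_le_of_ips_le`, `tendsto_radius`). -/

namespace ABC

/-! ### Empirical measures, symmetrization and concentration -/

section Empirical

variable {Y : Type*} [MeasurableSpace Y] {F : Set (Y → ℝ)} {n : ℕ}

instance (μ : Measure Y) [IsProbabilityMeasure μ] : IsProbabilityMeasure (sampleLaw μ n) := by
  unfold sampleLaw; infer_instance

theorem integral_empirical {f : Y → ℝ} (hf : Measurable f) (x : Fin n → Y) :
    ∫ y, f y ∂(empirical x) = (1 / (n : ℝ)) * ∑ i, f (x i) := by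
  unfold empirical
  rw [integral_smul_measure, integral_finsetSum_measure]
  · simp [integral_dirac' _ _ hf.stronglyMeasurable]
  · intro i _
    refine ⟨hf.aestronglyMeasurable, ?_⟩
    simp [HasFiniteIntegral, lintegral_dirac' _ hf.enorm]

theorem ofReal_le_ips {f : Y → ℝ} (hf : f ∈ F) (μ₁ μ₂ : Measure Y) :
    ENNReal.ofReal |(∫ y, f y ∂μ₁) - ∫ y, f y ∂μ₂| ≤ ips F μ₁ μ₂ :=
  le_iSup₂ (f := fun f (_ : f ∈ F) => ENNReal.ofReal |(∫ y, f y ∂μ₁) - ∫ y, f y ∂μ₂|) f hf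

theorem ips_comm (μ₁ μ₂ : Measure Y) : ips F μ₁ μ₂ = ips F μ₂ μ₁ := by
  simp only [ips, abs_sub_comm]

theorem ips_triangle (μ₁ μ₂ μ₃ : Measure Y) : ips F μ₁ μ₃ ≤ ips F μ₁ μ₂ + ips F μ₂ μ₃ := by
  refine iSup₂_le fun f hf => ?_
  refine le_trans ?_ (add_le_add (ofReal_le_ips hf μ₁ μ₂) (ofReal_le_ips hf μ₂ μ₃))
  rw [← ENNReal.ofReal_add (abs_nonneg _) (abs_nonneg _)]
  exact ENNReal.ofReal_le_ofReal (abs_sub_le _ _ _)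

theorem abs_integral_le_of_abs_le {f : Y → ℝ} {b : ℝ} (hfb : ∀ y, |f y| ≤ b) (μ : Measure Y)
    [IsProbabilityMeasure μ] : |∫ y, f y ∂μ| ≤ b := by
  simpa using norm_integral_le_of_norm_le_const (μ := μ) (f := f) (ae_of_all _ hfb)

theorem ips_ne_top {b : ℝ} (hFb : ∀ f ∈ F, ∀ y, |f y| ≤ b) (μ₁ μ₂ : Measure Y)
    [IsProbabilityMeasure μ₁] [IsProbabilityMeasure μ₂] : ips F μ₁ μ₂ ≠ ∞ := by
  refine ne_top_of_le_ne_top (b := ENNReal.ofReal (b + b)) ENNReal.ofReal_ne_top ?_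
  refine iSup₂_le fun f hf => ENNReal.ofReal_le_ofReal ?_
  exact (abs_sub _ _).trans (add_le_add (abs_integral_le_of_abs_le (hFb f hf) _)
    (abs_integral_le_of_abs_le (hFb f hf) _))

theorem integrable_of_abs_le {f : Y → ℝ} {b : ℝ} (hf : Measurable f) (hfb : ∀ y, |f y| ≤ b)
    (μ : Measure Y) [IsFiniteMeasure μ] : Integrable f μ :=
  Integrable.of_bound hf.aestronglyMeasurable b (ae_of_all _ hfb)

theorem integral_sampleLaw_empirical {f : Y → ℝ} {b : ℝ} (hf : Measurable f)
    (hfb : ∀ y, |f y| ≤ b) (hn : n ≠ 0) (μ : Measure Y) [IsProbabilityMeasure μ] :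
    ∫ z, (∫ y, f y ∂(empirical z)) ∂(sampleLaw μ n) = ∫ y, f y ∂μ := by
  have hmp (i : Fin n) : MeasurePreserving (Function.eval i) (sampleLaw μ n) μ :=
    measurePreserving_eval (fun _ : Fin n => μ) i
  have hint (i : Fin n) : Integrable (fun z : Fin n → Y => f (z i)) (sampleLaw μ n) :=
    (hmp i).integrable_comp_of_integrable (integrable_of_abs_le hf hfb μ)
  have heval (i : Fin n) : ∫ z, f (z i) ∂(sampleLaw μ n) = ∫ y, f y ∂μ :=
    integral_comp_eval (μ := fun _ : Fin n => μ) hf.aestronglyMeasurable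
  simp only [integral_empirical hf]
  rw [integral_const_mul, integral_finsetSum _ fun i _ => hint i]
  simp only [heval, Finset.sum_const, Finset.card_univ, Fintype.card_fin, nsmul_eq_mul]
  field_simp

/-- The average discrepancy between the empirical measure of a given sample and that of an
independent sample from `μ`. -/
noncomputable def ghostDiscrepancy (F : Set (Y → ℝ)) (μ : Measure Y) (z : Fin n → Y) : ℝ≥0∞ :=
  ∫⁻ z', ips F (empirical z) (empirical z') ∂(sampleLaw μ n)

/-- Jensen's inequality: `∫ f dμ` is the average of the ghost sample means. The right side is
measurable in `z` by Tonelli, whereas measurability of the left side is not assumed; good events are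
therefore defined through the right side. -/
theorem ips_empirical_le_ghostDiscrepancy {b : ℝ} (hF : ∀ f ∈ F, Measurable f)
    (hFb : ∀ f ∈ F, ∀ y, |f y| ≤ b) (hn : n ≠ 0) (μ : Measure Y) [IsProbabilityMeasure μ]
    (z : Fin n → Y) : ips F (empirical z) μ ≤ ghostDiscrepancy F μ z := by
  refine iSup₂_le fun f hf => ?_
  have hint : Integrable (fun z' : Fin n → Y => ∫ y, f y ∂(empirical z')) (sampleLaw μ n) := by
    simp only [integral_empirical (hF f hf)]
    refine (integrable_finsetSum _ fun i _ => ?_).const_mul _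
    exact (measurePreserving_eval (fun _ : Fin n => μ) i).integrable_comp_of_integrable
      (integrable_of_abs_le (hF f hf) (hFb f hf) μ)
  have hsub : (∫ y, f y ∂(empirical z)) - ∫ y, f y ∂μ
      = ∫ z', ((∫ y, f y ∂(empirical z)) - ∫ y, f y ∂(empirical z')) ∂(sampleLaw μ n) := by
    rw [integral_sub (integrable_const _) hint,
      integral_sampleLaw_empirical (hF f hf) (hFb f hf) hn]
    simp
  rw [hsub, ← Real.norm_eq_abs, ofReal_norm]
  refine (enorm_integral_le_lintegral_enorm _).trans (lintegral_mono fun z' => ?_)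
  rw [← ofReal_norm, Real.norm_eq_abs]
  exact ofReal_le_ips hf _ _

theorem measurable_ghostDiscrepancy
    (hD : Measurable fun p : (Fin n → Y) × (Fin n → Y) => ips F (empirical p.1) (empirical p.2))
    (μ : Measure Y) [IsProbabilityMeasure μ] :
    Measurable fun z : Fin n → Y => ghostDiscrepancy F μ z :=
  hD.lintegral_prod_right'

theorem measurableSet_lt_ghostDiscrepancy
    (hD : Measurable fun p : (Fin n → Y) × (Fin n → Y) => ips F (empirical p.1) (empirical p.2))
    (μ : Measure Y) [IsProbabilityMeasure μ] (t : ℝ≥0∞) :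
    MeasurableSet {z : Fin n → Y | t < ghostDiscrepancy F μ z} :=
  measurableSet_lt measurable_const (measurable_ghostDiscrepancy hD μ)

/-- Exchange the coordinates of two samples at the places where the sign is `-1`. -/
def swapAt (e : Fin n → ℤˣ) (p : (Fin n → Y) × (Fin n → Y)) : (Fin n → Y) × (Fin n → Y) :=
  (fun i => if e i = 1 then p.1 i else p.2 i, fun i => if e i = 1 then p.2 i else p.1 i)

/-- The pairs `(z i, z' i)` are independent with law `μ.prod μ`, which is invariant under exchange.
-/
theorem measurePreserving_swapAt (e : Fin n → ℤˣ) (μ : Measure Y) [IsProbabilityMeasure μ] :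
    MeasurePreserving (swapAt e) ((sampleLaw μ n).prod (sampleLaw μ n))
      ((sampleLaw μ n).prod (sampleLaw μ n)) := by
  have h1 := measurePreserving_arrowProdEquivProdArrow Y Y (Fin n) (fun _ => μ) (fun _ => μ)
  have h2 := measurePreserving_pi (fun _ : Fin n => μ.prod μ) (fun _ : Fin n => μ.prod μ)
    (f := fun i p => if e i = 1 then p else p.swap) fun i => by
      by_cases h : e i = 1
      · simp only [h, if_true]
        exact MeasurePreserving.id (μ.prod μ)
      · simpa [h] using Measure.measurePreserving_swap (μ := μ) (ν := μ)
  unfold sampleLaw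
  convert (h1.comp h2).comp h1.symm using 1
  funext p
  refine Prod.ext ?_ ?_ <;> funext i <;> by_cases h : e i = 1 <;>
    simp [swapAt, h, MeasurableEquiv.arrowProdEquivProdArrow, Equiv.arrowProdEquivProdArrow]

theorem ips_swapAt_le (hF : ∀ f ∈ F, Measurable f) (e : Fin n → ℤˣ)
    (p : (Fin n → Y) × (Fin n → Y)) :
    ips F (empirical (swapAt e p).1) (empirical (swapAt e p).2)
      ≤ signedSup F e p.1 + signedSup F e p.2 := by
  refine iSup₂_le fun f hf => ?_
  have hle (x : Fin n → Y) :
      ENNReal.ofReal |(1 / (n : ℝ)) * ∑ i, ((e i : ℤ) : ℝ) * f (x i)| ≤ signedSup F e x :=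
    le_iSup₂ (f := fun f (_ : f ∈ F) =>
      ENNReal.ofReal |(1 / (n : ℝ)) * ∑ i, ((e i : ℤ) : ℝ) * f (x i)|) f hf
  refine le_trans ?_ (add_le_add (hle p.1) (hle p.2))
  rw [← ENNReal.ofReal_add (abs_nonneg _) (abs_nonneg _)]
  refine ENNReal.ofReal_le_ofReal (le_trans (le_of_eq ?_) (abs_sub _ _))
  rw [integral_empirical (hF f hf), integral_empirical (hF f hf), ← mul_sub, ← mul_sub,
    ← Finset.sum_sub_distrib, ← Finset.sum_sub_distrib]
  congr 2
  refine Finset.sum_congr rfl fun i _ => ?_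
  rcases Int.units_eq_one_or (e i) with h | h
  · simp [swapAt, h]
  · simp [swapAt, h]
    ring

/-- **Symmetrization**: the mean discrepancy between two independent empirical measures is at most
twice the Rademacher complexity. -/
theorem lintegral_ghostDiscrepancy_le (hF : ∀ f ∈ F, Measurable f)
    (hD : Measurable fun p : (Fin n → Y) × (Fin n → Y) => ips F (empirical p.1) (empirical p.2))
    (hR : ∀ e : Fin n → ℤˣ, Measurable fun x : Fin n → Y => signedSup F e x)
    (μ : Measure Y) [IsProbabilityMeasure μ] :
    ∫⁻ z : Fin n → Y, ghostDiscrepancy F μ z ∂(sampleLaw μ n) ≤ 2 * rademacher F μ n := by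
  set I := ∫⁻ z : Fin n → Y, ghostDiscrepancy F μ z ∂(sampleLaw μ n)
  -- The bound holds for each fixed sign vector; averaging over the `2 ^ n` vectors then produces
  -- the Rademacher complexity.
  have hstep (e : Fin n → ℤˣ) : I ≤ 2 * ∫⁻ x, signedSup F e x ∂(sampleLaw μ n) := by
    have hI' : I = ∫⁻ p, ips F (empirical p.1) (empirical p.2)
        ∂((sampleLaw μ n).prod (sampleLaw μ n)) := by
      rw [lintegral_prod _ hD.aemeasurable]; rfl
    rw [hI', ← (measurePreserving_swapAt e μ).lintegral_comp hD]
    refine (lintegral_mono fun p => ips_swapAt_le hF e p).trans (le_of_eq ?_)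
    rw [lintegral_add_left (f := fun p : (Fin n → Y) × (Fin n → Y) => signedSup F e p.1)
      ((hR e).comp measurable_fst), two_mul]
    congr 1
    · exact (measurePreserving_fst (μ := sampleLaw μ n) (ν := sampleLaw μ n)).lintegral_comp (hR e)
    · exact (measurePreserving_snd (μ := sampleLaw μ n) (ν := sampleLaw μ n)).lintegral_comp (hR e)
  have hsum : (2 : ℝ≥0∞) ^ n * I
      ≤ 2 * ∑ e : Fin n → ℤˣ, ∫⁻ x, signedSup F e x ∂(sampleLaw μ n) := by
    rw [Finset.mul_sum]
    refine le_trans (le_of_eq ?_) (Finset.sum_le_sum fun e _ => hstep e)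
    simp
  have h0 : (2 : ℝ≥0∞) ^ n ≠ 0 := by positivity
  have ht : (2 : ℝ≥0∞) ^ n ≠ ∞ := by finiteness
  calc I = ((2 : ℝ≥0∞) ^ n)⁻¹ * (2 ^ n * I) := by
        rw [← mul_assoc, ENNReal.inv_mul_cancel h0 ht, one_mul]
    _ ≤ ((2 : ℝ≥0∞) ^ n)⁻¹ * (2 * ∑ e : Fin n → ℤˣ, ∫⁻ x, signedSup F e x ∂(sampleLaw μ n)) := by
        gcongr
    _ = 2 * rademacher F μ n := by unfold rademacher; ring

theorem sampleLaw_ghostDiscrepancy_gt_le (hF : ∀ f ∈ F, Measurable f)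
    (hD : Measurable fun p : (Fin n → Y) × (Fin n → Y) => ips F (empirical p.1) (empirical p.2))
    (hR : ∀ e : Fin n → ℤˣ, Measurable fun x : Fin n → Y => signedSup F e x)
    (μ : Measure Y) [IsProbabilityMeasure μ] {t : ℝ≥0∞} (ht0 : t ≠ 0) (ht : t ≠ ∞) :
    sampleLaw μ n {z | t < ghostDiscrepancy F μ z} ≤ 2 * supRademacher F n / t := by
  refine (measure_mono fun z (hz : t < _) => hz.le).trans
    ((meas_ge_le_lintegral_div (measurable_ghostDiscrepancy hD μ).aemeasurable ht0 ht).trans ?_)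
  refine ENNReal.div_le_div_right ((lintegral_ghostDiscrepancy_le hF hD hR μ).trans ?_) _
  gcongr
  exact le_iSup (fun μ : ProbabilityMeasure Y => rademacher F (μ : Measure Y) n) ⟨μ, ‹_›⟩

/-- Hoeffding's inequality for one function with values in `[-b, b]`: each centred term has variance
proxy `b ^ 2`. -/
theorem sampleLaw_empirical_upper_deviation_le {f : Y → ℝ} {b : ℝ} (hf : Measurable f)
    (hb : 0 < b) (hfb : ∀ y, |f y| ≤ b) (hn : n ≠ 0) (μ : Measure Y) [IsProbabilityMeasure μ]
    {s : ℝ} (hs : 0 ≤ s) :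
    sampleLaw μ n {z | s ≤ (∫ y, f y ∂(empirical z)) - ∫ y, f y ∂μ}
      ≤ ENNReal.ofReal (Real.exp (-(n * s ^ 2 / (2 * b ^ 2)))) := by
  have hmp (i : Fin n) : MeasurePreserving (Function.eval i) (sampleLaw μ n) μ :=
    measurePreserving_eval (fun _ : Fin n => μ) i
  have hind : iIndepFun (fun i (z : Fin n → Y) => f (z i) - ∫ y, f y ∂μ) (sampleLaw μ n) :=
    iIndepFun_pi (μ := fun _ : Fin n => μ) (X := fun _ y => f y - ∫ y, f y ∂μ)
      fun _ => (hf.sub_const _).aemeasurable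
  have hsub (i : Fin n) : HasSubgaussianMGF (fun z : Fin n → Y => f (z i) - ∫ y, f y ∂μ)
      ((‖b - -b‖₊ / 2) ^ 2) (sampleLaw μ n) := by
    have h := hasSubgaussianMGF_of_mem_Icc (μ := sampleLaw μ n)
      (X := fun z : Fin n → Y => f (z i)) (a := -b) (b := b)
      (hf.comp (measurable_pi_apply i)).aemeasurable (ae_of_all _ fun z => abs_le.1 (hfb (z i)))
    rwa [show ∫ z, f (z i) ∂(sampleLaw μ n) = ∫ y, f y ∂μ from
      integral_comp_eval (μ := fun _ : Fin n => μ) hf.aestronglyMeasurable] at h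
  have hn' : (0 : ℝ) < n := by positivity
  have hH := HasSubgaussianMGF.measure_sum_ge_le_of_iIndepFun hind (s := Finset.univ)
    (fun i _ => hsub i) (ε := n * s) (by positivity)
  have hset : {z : Fin n → Y | s ≤ (∫ y, f y ∂(empirical z)) - ∫ y, f y ∂μ}
      = {z | n * s ≤ ∑ i, (f (z i) - ∫ y, f y ∂μ)} := by
    ext z
    simp only [Set.mem_ofPred_eq, integral_empirical hf, Finset.sum_sub_distrib, Finset.sum_const,
      Finset.card_univ, Fintype.card_fin, nsmul_eq_mul]
    rw [← mul_le_mul_iff_right₀ hn', mul_sub, ← mul_assoc, mul_one_div_cancel hn'.ne', one_mul]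
  rw [hset, ← ofReal_measureReal]
  refine ENNReal.ofReal_le_ofReal (hH.trans (le_of_eq ?_))
  have hc : ((∑ _i : Fin n, (‖b - -b‖₊ / 2) ^ 2 : NNReal) : ℝ) = n * b ^ 2 := by
    have : |b + b| = b + b := abs_of_pos (by linarith)
    simp [this]
  rw [hc]
  congr 1
  field_simp

/-- The sign of the gap between `∫ f dμ` and `a` is fixed, so only one tail is needed and no factor
`2` appears. -/
theorem sampleLaw_empirical_abs_deviation_le {f : Y → ℝ} {b : ℝ} (hf : Measurable f)
    (hb : 0 < b) (hfb : ∀ y, |f y| ≤ b) (hn : n ≠ 0) (μ : Measure Y) [IsProbabilityMeasure μ]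
    {s a c : ℝ} (hs : 0 ≤ s) (h : c + s < |(∫ y, f y ∂μ) - a|) :
    sampleLaw μ n {z | |(∫ y, f y ∂(empirical z)) - a| ≤ c}
      ≤ ENNReal.ofReal (Real.exp (-(n * s ^ 2 / (2 * b ^ 2)))) := by
  rcases lt_abs.1 h with h | h
  · refine (measure_mono fun z (hz : |_| ≤ c) => ?_).trans
      (sampleLaw_empirical_upper_deviation_le (f := fun y => -f y) hf.neg hb
        (by simpa using hfb) hn μ hs)
    simp only [Set.mem_ofPred_eq, integral_neg]
    linarith [(abs_le.1 hz).2]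
  · refine (measure_mono fun z (hz : |_| ≤ c) => ?_).trans
      (sampleLaw_empirical_upper_deviation_le hf hb hfb hn μ hs)
    simp only [Set.mem_ofPred_eq]
    linarith [(abs_le.1 hz).1]

end Empirical

theorem abcPosterior_le {Θ Y : Type*} [MeasurableSpace Θ] [MeasurableSpace Y] {F : Set (Y → ℝ)}
    {n : ℕ} {model : Kernel Θ Y} {prior : Measure Θ} {ε c : ℝ≥0∞}
    [IsProbabilityMeasure prior] {y : Fin n → Y} {A : Set Θ}
    (hA : ∀ θ ∈ A, acceptProb F model ε y θ ≤ c) :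
    abcPosterior F model prior ε y A ≤ (acceptMass F model prior ε y)⁻¹ * c := by
  rw [abcPosterior, Measure.smul_apply, smul_eq_mul, withDensity_apply']
  gcongr
  calc ∫⁻ θ in A, acceptProb F model ε y θ ∂prior ≤ c * prior A := by
        rw [← setLIntegral_const]
        exact setLIntegral_mono measurable_const hA
    _ ≤ c := mul_le_of_le_one_right' prob_le_one

/-! ### Acceptance probabilities and the radius -/

section Posterior

variable {Θ Y : Type*} [MeasurableSpace Θ] [MeasurableSpace Y] {F : Set (Y → ℝ)} {n : ℕ}
  {model : Kernel Θ Y} [IsMarkovKernel model]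

/-- On rectangles the product law is a finite product of measurable functions of `θ`, and rectangles
form a generating π-system. -/
theorem measurable_sampleLaw (model : Kernel Θ Y) [IsMarkovKernel model] (n : ℕ) :
    Measurable fun θ => sampleLaw (model θ) n := by
  refine Measurable.measure_of_isPiSystem_of_isProbabilityMeasure generateFrom_pi.symm
    isPiSystem_pi ?_
  rintro _ ⟨s, hs, rfl⟩
  simp only [sampleLaw, Measure.pi_pi]
  exact Finset.measurable_prod _ fun i _ => model.measurable_coe (hs i trivial)

theorem measurableSet_accepted
    (hD : Measurable fun p : (Fin n → Y) × (Fin n → Y) => ips F (empirical p.1) (empirical p.2))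
    (ε : ℝ≥0∞) (y : Fin n → Y) :
    MeasurableSet {z : Fin n → Y | ips F (empirical z) (empirical y) ≤ ε} :=
  (hD.comp (measurable_id.prodMk measurable_const)) measurableSet_Iic

theorem measurable_acceptProb
    (hD : Measurable fun p : (Fin n → Y) × (Fin n → Y) => ips F (empirical p.1) (empirical p.2))
    (ε : ℝ≥0∞) (y : Fin n → Y) : Measurable (acceptProb F model ε y) :=
  (Measure.measurable_coe (measurableSet_accepted hD ε y)).comp (measurable_sampleLaw model n)

/-- The three copies of `t` pay for the synthetic sample's fluctuation, the excess discrepancy of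
`θ`, and the data's fluctuation. -/
theorem half_le_acceptProb {b : ℝ} (hF : ∀ f ∈ F, Measurable f)
    (hFb : ∀ f ∈ F, ∀ y, |f y| ≤ b) (hn : n ≠ 0)
    (hD : Measurable fun p : (Fin n → Y) × (Fin n → Y) => ips F (empirical p.1) (empirical p.2))
    (hR : ∀ e : Fin n → ℤˣ, Measurable fun x : Fin n → Y => signedSup F e x)
    {μstar : Measure Y} [IsProbabilityMeasure μstar] {m t : ℝ≥0∞} (ht0 : t ≠ 0) (ht : t ≠ ∞)
    (hRt : 2 * supRademacher F n / t ≤ 2⁻¹) {y : Fin n → Y} (hy : ghostDiscrepancy F μstar y ≤ t)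
    {θ : Θ} (hθ : ips F (model θ) μstar ≤ m + t) :
    2⁻¹ ≤ acceptProb F model (m + 3 * t) y θ := by
  have hsub : {z : Fin n → Y | t < ghostDiscrepancy F (model θ) z}ᶜ
      ⊆ {z | ips F (empirical z) (empirical y) ≤ m + 3 * t} := by
    intro z hz
    have hz' : ghostDiscrepancy F (model θ) z ≤ t := not_lt.1 hz
    calc ips F (empirical z) (empirical y)
        ≤ ips F (empirical z) (model θ) + ips F (model θ) (empirical y) := ips_triangle _ _ _
      _ ≤ ips F (empirical z) (model θ) + (ips F (model θ) μstar + ips F μstar (empirical y)) := by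
          gcongr; exact ips_triangle _ _ _
      _ ≤ t + ((m + t) + t) := by
          gcongr
          · exact (ips_empirical_le_ghostDiscrepancy hF hFb hn _ _).trans hz'
          · rw [ips_comm]
            exact (ips_empirical_le_ghostDiscrepancy hF hFb hn _ _).trans hy
      _ = m + 3 * t := by ring
  refine le_trans ?_ (measure_mono hsub)
  rw [prob_compl_eq_one_sub (measurableSet_lt_ghostDiscrepancy hD _ t)]
  have h := (sampleLaw_ghostDiscrepancy_gt_le hF hD hR (model θ) ht0 ht).trans hRt
  calc (2⁻¹ : ℝ≥0∞) = 1 - 2⁻¹ := by simp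
    _ ≤ _ := tsub_le_tsub_left h 1

/-- A strict lower bound on a supremum is attained by some `f`, so concentration of that one `f`
suffices and no uniform deviation bound is needed. -/
theorem acceptProb_le {b : ℝ} (hF : ∀ f ∈ F, Measurable f) (hb : 0 < b)
    (hFb : ∀ f ∈ F, ∀ y, |f y| ≤ b) (hn : n ≠ 0)
    {μstar : Measure Y} [IsProbabilityMeasure μstar] {m t s : ℝ} (hm : 0 ≤ m) (ht : 0 ≤ t)
    (hs : 0 ≤ s) {y : Fin n → Y} (hy : ips F (empirical y) μstar ≤ ENNReal.ofReal t)
    {θ : Θ} (hθ : ENNReal.ofReal (m + (t + s)) < ips F (model θ) μstar) :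
    acceptProb F model (ENNReal.ofReal m) y θ
      ≤ ENNReal.ofReal (Real.exp (-(n * s ^ 2 / (2 * b ^ 2)))) := by
  obtain ⟨f, hf, hlt⟩ : ∃ f ∈ F, ENNReal.ofReal (m + (t + s))
      < ENNReal.ofReal |(∫ y, f y ∂(model θ)) - ∫ y, f y ∂μstar| := by
    simpa [ips, lt_iSup_iff] using hθ
  replace hlt := (ENNReal.ofReal_lt_ofReal_iff_of_nonneg (by positivity)).1 hlt
  have hyf : |(∫ y, f y ∂(empirical y)) - ∫ y, f y ∂μstar| ≤ t :=
    (ENNReal.ofReal_le_ofReal_iff ht).1 ((ofReal_le_ips hf _ _).trans hy)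
  refine (measure_mono fun z (hz : ips F _ _ ≤ _) => ?_).trans
    (sampleLaw_empirical_abs_deviation_le (hF f hf) hb (hFb f hf) hn (model θ) hs
      (a := ∫ y, f y ∂(empirical y)) (c := m) ?_)
  · exact (ENNReal.ofReal_le_ofReal_iff hm).1 ((ofReal_le_ips hf _ _).trans hz)
  · have := abs_sub_le (∫ y, f y ∂(model θ)) (∫ y, f y ∂(empirical y)) (∫ y, f y ∂μstar)
    linarith

theorem exp_neg_sqrt_log {n L b ε : ℝ} (hn : 1 ≤ n) (hL : 0 < L) (hb : 0 < b) (hε : 0 < ε)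
    (hε1 : ε ≤ 1) :
    Real.exp (-(n * Real.sqrt (2 * b ^ 2 / n * Real.log (n / ε ^ L)) ^ 2 / (2 * b ^ 2)))
      = ε ^ L / n := by
  have hn0 : 0 < n := by linarith
  have hεL : 0 < ε ^ L := Real.rpow_pos_of_pos hε L
  have hlog : 0 ≤ Real.log (n / ε ^ L) := Real.log_nonneg
    ((one_le_div hεL).2 ((Real.rpow_le_one hε.le hε1 hL.le).trans hn))
  rw [Real.sq_sqrt (by positivity)]
  have : n * (2 * b ^ 2 / n * Real.log (n / ε ^ L)) / (2 * b ^ 2) = Real.log (n / ε ^ L) := by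
    field_simp
  rw [this, Real.exp_neg, Real.exp_log (by positivity), inv_div]

theorem tendsto_radius {b L : ℝ} {εbar : ℕ → ℝ} (hL : 0 < L)
    (hR : Tendsto (supRademacher F) atTop (𝓝 0)) (hε : Tendsto εbar atTop (𝓝 0))
    (hpos : ∀ᶠ n in atTop, 0 < εbar n)
    (hnε : Tendsto (fun n : ℕ => (n : ℝ) * εbar n ^ 2) atTop atTop) :
    Tendsto (fun n => radius F b L (εbar n) n) atTop (𝓝 0) := by
  have hlogn : Tendsto (fun n : ℕ => Real.log n / n) atTop (𝓝 0) :=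
    (Real.isLittleO_log_id_atTop.tendsto_div_nhds_zero).comp tendsto_natCast_atTop_atTop
  have hlog : Tendsto (fun n : ℕ => 2 * b ^ 2 / n * Real.log (n / εbar n ^ L)) atTop (𝓝 0) := by
    have hup : Tendsto (fun n : ℕ => 2 * b ^ 2 * (1 + L / 2) * (Real.log n / n)) atTop (𝓝 0) := by
      simpa using hlogn.const_mul (2 * b ^ 2 * (1 + L / 2))
    refine tendsto_of_tendsto_of_tendsto_of_le_of_le' tendsto_const_nhds hup ?_ ?_
    · filter_upwards [hpos, eventually_ge_atTop 1, hε.eventually_le_const one_pos] with n h0 hn h1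
      have hεL : 0 < εbar n ^ L := Real.rpow_pos_of_pos h0 L
      have hn' : (1 : ℝ) ≤ n := by exact_mod_cast hn
      have := Real.log_nonneg
        ((one_le_div hεL).2 ((Real.rpow_le_one h0.le h1 hL.le).trans hn'))
      positivity
    · filter_upwards [hpos, eventually_ge_atTop 1, hnε.eventually_ge_atTop 1] with n h0 hn h1
      have hεL : 0 < εbar n ^ L := Real.rpow_pos_of_pos h0 L
      have hn' : (0 : ℝ) < n := by positivity
      -- From `n ε̄ ^ 2 ≥ 1`, `-log ε̄` is at most half of `log n`, so the logarithm in the radius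
      -- is `O(log n)`.
      have h2 : 0 ≤ Real.log n + 2 * Real.log (εbar n) := by
        have := Real.log_nonneg h1
        rwa [Real.log_mul hn'.ne' (by positivity), Real.log_pow] at this
      rw [Real.log_div hn'.ne' hεL.ne', Real.log_rpow h0]
      have h3 : Real.log n - L * Real.log (εbar n) ≤ (1 + L / 2) * Real.log n := by nlinarith
      calc 2 * b ^ 2 / n * (Real.log n - L * Real.log (εbar n))
          ≤ 2 * b ^ 2 / n * ((1 + L / 2) * Real.log n) := by gcongr
        _ = _ := by ring
  have hR' : Tendsto (fun n => (supRademacher F n).toReal) atTop (𝓝 0) := by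
    simpa [Function.comp_def] using (ENNReal.tendsto_toReal ENNReal.zero_ne_top).comp hR
  have hsqrt := (Real.continuous_sqrt.tendsto 0).comp hlog
  simpa [radius, Function.comp_def] using
    (((hε.const_mul 4).div_const 3).add (hR'.const_mul 2)).add hsqrt

end Posterior

/-! ### From discrepancy to distance, and the denominator -/

theorem dist_le_of_ips_le {Θ Y : Type*} [MeasurableSpace Y] [MetricSpace Θ] [MeasurableSpace Θ]
    {F : Set (Y → ℝ)} {model : Kernel Θ Y} {μstar : Measure Y} {θstar : Θ}
    (hsep : ∀ δ : ℝ, 0 < δ → ∃ δ' : ℝ, 0 < δ' ∧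
      ips F (model θstar) μstar + ENNReal.ofReal δ' <
        ⨅ θ ∈ {θ : Θ | δ < dist θ θstar}, ips F (model θ) μstar)
    {K ν : ℝ} (hK : 0 < K) (hν : 0 < ν) {U : Set Θ} (hU : IsOpen U) (hθU : θstar ∈ U)
    (hctrl : ∀ θ ∈ U, ENNReal.ofReal (dist θ θstar) ≤ ENNReal.ofReal K *
      (ips F (model θ) μstar - minDiscrepancy F model μstar) ^ ν) :
    ∃ r₀ : ℝ, 0 < r₀ ∧ ∀ r, 0 ≤ r → r ≤ r₀ → ∀ θ,
      ips F (model θ) μstar ≤ minDiscrepancy F model μstar + ENNReal.ofReal r →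
      dist θ θstar ≤ K * r ^ ν := by
  obtain ⟨δ, hδ, hball⟩ := Metric.isOpen_iff.1 hU θstar hθU
  obtain ⟨r₀, hr₀, hlt⟩ := hsep (δ / 2) (by positivity)
  refine ⟨r₀, hr₀, fun r hr hrr θ hθ => ?_⟩
  -- Excess discrepancy at most the separation gap `r₀` forces `θ` into the ball inside `U`, where
  -- the local control applies.
  have hθ' : dist θ θstar ≤ δ / 2 := by
    by_contra! hd
    refine absurd hlt (not_lt.2 ((iInf₂_le θ hd).trans (hθ.trans ?_)))
    exact add_le_add (iInf_le _ θstar) (ENNReal.ofReal_le_ofReal hrr)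
  have h := hctrl θ (hball (Metric.mem_ball.2 (by linarith)))
  have h2 : ENNReal.ofReal K * (ips F (model θ) μstar - minDiscrepancy F model μstar) ^ ν
      ≤ ENNReal.ofReal (K * r ^ ν) := by
    rw [ENNReal.ofReal_mul hK.le, ← ENNReal.ofReal_rpow_of_nonneg hr hν.le]
    gcongr
    exact tsub_le_iff_left.2 hθ
  exact (ENNReal.ofReal_le_ofReal_iff (by positivity)).1 (h.trans h2)

/-- Lower bound for the acceptance probability by the prior mass of the near-minimizers. -/
theorem acceptMass_ge {Θ Y : Type*} [MeasurableSpace Θ] [MeasurableSpace Y] {F : Set (Y → ℝ)}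
    {n : ℕ} {model : Kernel Θ Y} [IsMarkovKernel model] {prior : Measure Θ}
    {b : ℝ} (hF : ∀ f ∈ F, Measurable f)
    (hFb : ∀ f ∈ F, ∀ y, |f y| ≤ b) (hn : n ≠ 0)
    (hD : Measurable fun p : (Fin n → Y) × (Fin n → Y) => ips F (empirical p.1) (empirical p.2))
    (hR : ∀ e : Fin n → ℤˣ, Measurable fun x : Fin n → Y => signedSup F e x)
    {μstar : Measure Y} [IsProbabilityMeasure μstar] {m t : ℝ≥0∞} (ht0 : t ≠ 0) (ht : t ≠ ∞)
    (hRt : 2 * supRademacher F n / t ≤ 2⁻¹) {y : Fin n → Y}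
    (hy : ghostDiscrepancy F μstar y ≤ t) :
    2⁻¹ * prior {θ | ips F (model θ) μstar ≤ m + t}
      ≤ acceptMass F model prior (m + 3 * t) y := by
  -- Markov's inequality read backwards: the integral is at least `1/2` times the prior mass where
  -- acceptance has probability at least `1/2`.
  refine le_trans ?_ (mul_meas_ge_le_lintegral (measurable_acceptProb (model := model) hD _ y) 2⁻¹)
  exact mul_le_mul_right (measure_mono fun θ hθ =>
    half_le_acceptProb hF hFb hn hD hR ht0 ht hRt hy hθ) _

end ABC

/-! ### Assembly -/

open ABC in
theorem mainTheorem10 {Y Θ : Type*} [MeasurableSpace Y]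
    [MetricSpace Θ] [MeasurableSpace Θ] [OpensMeasurableSpace Θ]
    -- the class of functions, the model, the prior, the true distribution, the minimizer
    (F : Set (Y → ℝ)) (model : Kernel Θ Y) [IsMarkovKernel model]
    (prior : Measure Θ) [IsProbabilityMeasure prior]
    (μstar : Measure Y) [IsProbabilityMeasure μstar] (θstar : Θ)
    -- measurability of the functions and of the suprema over the class
    (hF : ∀ f ∈ F, Measurable f)
    (hD_meas : ∀ n : ℕ, Measurable fun p : (Fin n → Y) × (Fin n → Y) =>
      ABC.ips F (ABC.empirical p.1) (ABC.empirical p.2))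
    (hR_meas : ∀ (n : ℕ) (e : Fin n → ℤˣ), Measurable fun x : Fin n → Y => ABC.signedSup F e x)
    -- prior mass near the lowest attainable discrepancy
    (L cπ : ℝ) (hL : 0 < L) (hcπ : 0 < cπ)
    (hprior : ∀ᶠ ε : ℝ in 𝓝[>] 0, ENNReal.ofReal (cπ * ε ^ L) ≤
      prior {θ | ABC.ips F (model θ) μstar ≤
        ABC.minDiscrepancy F model μstar + ENNReal.ofReal ε})
    -- uniform boundedness of the class
    (b : ℝ) (hb : 0 < b) (hFb : ∀ f ∈ F, ∀ y, |f y| ≤ b)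
    -- vanishing worst-case Rademacher complexity
    (hR : Tendsto (ABC.supRademacher F) atTop (𝓝 0))
    -- existence and well-separation of the minimizer
    (hmin : ∀ θ, ABC.ips F (model θstar) μstar ≤ ABC.ips F (model θ) μstar)
    (hsep : ∀ δ : ℝ, 0 < δ → ∃ δ' : ℝ, 0 < δ' ∧
      ABC.ips F (model θstar) μstar + ENNReal.ofReal δ' <
        ⨅ θ ∈ {θ : Θ | δ < dist θ θstar}, ABC.ips F (model θ) μstar)
    -- identifiability, and control of the distance by the discrepancy near the minimizer
    (hident : Function.Injective model)
    (K ν : ℝ) (hK : 0 < K) (hν : 0 < ν) (U : Set Θ) (hU : IsOpen U) (hθU : θstar ∈ U)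
    (hctrl : ∀ θ ∈ U, ENNReal.ofReal (dist θ θstar) ≤ ENNReal.ofReal K *
      (ABC.ips F (model θ) μstar - ABC.minDiscrepancy F model μstar) ^ ν)
    -- the thresholds
    (εbar : ℕ → ℝ) (hε : Tendsto εbar atTop (𝓝 0))
    (hnε : Tendsto (fun n : ℕ => (n : ℝ) * εbar n ^ 2) atTop atTop)
    (hεR : Tendsto (fun n : ℕ => ENNReal.ofReal (εbar n) / ABC.supRademacher F n) atTop (𝓝 ⊤)) :
    Tendsto (fun n : ℕ => ABC.sampleLaw μstar n {y : Fin n → Y |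
        ABC.acceptMass F model prior
          (ABC.minDiscrepancy F model μstar + ENNReal.ofReal (εbar n)) y ≠ 0 ∧
        ABC.abcPosterior F model prior
          (ABC.minDiscrepancy F model μstar + ENNReal.ofReal (εbar n)) y
          {θ : Θ | K * ABC.radius F b L (εbar n) n ^ ν < dist θ θstar}
          ≤ ENNReal.ofReal (2 * 3 ^ L / (cπ * n))})
      atTop (𝓝 1) := by

  -- A nonpositive threshold increment would make the ratio in `hεR` equal to `0`, even when the
  -- complexity vanishes.
  have hpos : ∀ᶠ n in atTop, 0 < εbar n := by
    filter_upwards [hεR.eventually_const_lt ENNReal.zero_lt_top] with n hn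
    by_contra! h
    simp [ENNReal.ofReal_of_nonpos h] at hn
  obtain ⟨r₀, hr₀, hdist⟩ := dist_le_of_ips_le hsep hK hν hU hθU hctrl
  have hrad := tendsto_radius (b := b) hL hR hε hpos hnε
  have hratio : Tendsto (fun n => 2 * supRademacher F n / ENNReal.ofReal (εbar n / 3))
      atTop (𝓝 0) := by
    have h6 : Tendsto (fun n => 6 * (ENNReal.ofReal (εbar n) / supRademacher F n)⁻¹)
        atTop (𝓝 0) := by
      simpa using ENNReal.Tendsto.const_mul (a := 6) hεR.inv (Or.inr (by norm_num))
    refine h6.congr' ?_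
    filter_upwards [hpos] with n h0
    have he : ENNReal.ofReal (εbar n) ≠ 0 := by simpa using h0
    rw [ENNReal.inv_div (Or.inr ENNReal.ofReal_ne_top) (Or.inr he),
      ENNReal.ofReal_div_of_pos (by norm_num), div_eq_mul_inv, div_eq_mul_inv,
      ENNReal.inv_div (Or.inr ENNReal.ofReal_ne_top) (Or.inr he), div_eq_mul_inv]
    simp only [ENNReal.ofReal_ofNat]
    ring
  have hm_ne : minDiscrepancy F model μstar ≠ ∞ :=
    ne_top_of_le_ne_top (ips_ne_top hFb (model θstar) μstar) (iInf_le _ θstar)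
  have hlow : Tendsto (fun n => 1 - 2 * supRademacher F n / ENNReal.ofReal (εbar n / 3))
      atTop (𝓝 1) := by
    simpa using ENNReal.Tendsto.sub (tendsto_const_nhds (x := (1 : ℝ≥0∞))) hratio
      (Or.inl ENNReal.one_ne_top)
  have hε3 : Tendsto (fun n => εbar n / 3) atTop (𝓝[>] 0) := by
    refine tendsto_nhdsWithin_iff.2 ⟨by simpa using hε.div_const 3, ?_⟩
    filter_upwards [hpos] with n h0
    exact div_pos h0 (by norm_num)
  refine tendsto_of_tendsto_of_tendsto_of_le_of_le' hlow tendsto_const_nhds ?_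
    (Eventually.of_forall fun n => prob_le_one)
  filter_upwards [hpos, eventually_ge_atTop 1, hε.eventually_le_const one_pos,
    hε3.eventually hprior, hratio.eventually_le_const (show (0 : ℝ≥0∞) < 2⁻¹ by simp),
    hrad.eventually_le_const hr₀] with n h0 hn h1 hpr hhalf hr
  set m := minDiscrepancy F model μstar
  set t := ENNReal.ofReal (εbar n / 3) with ht
  have hn0 : n ≠ 0 := by omega
  have hn1 : (1 : ℝ) ≤ n := by exact_mod_cast hn
  have hεL : 0 < εbar n ^ L := Real.rpow_pos_of_pos h0 L
  have ht0 : t ≠ 0 := by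
    rw [ht]; simpa using h0
  have h3t : m + ENNReal.ofReal (εbar n) = m + 3 * t := by
    rw [ht, ← ENNReal.ofReal_ofNat 3, ← ENNReal.ofReal_mul (by norm_num)]
    congr 2
    ring
  have hgood : 1 - 2 * supRademacher F n / t
      ≤ sampleLaw μstar n {y | t < ghostDiscrepancy F μstar y}ᶜ := by
    rw [prob_compl_eq_one_sub (measurableSet_lt_ghostDiscrepancy (hD_meas n) _ t)]
    exact tsub_le_tsub_left (sampleLaw_ghostDiscrepancy_gt_le hF (hD_meas n) (hR_meas n) μstar ht0
      ENNReal.ofReal_ne_top) 1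
  -- Monotonicity of the measure suffices: the target event itself need not be measurable.
  refine hgood.trans (measure_mono fun y hy => ?_)
  replace hy : ghostDiscrepancy F μstar y ≤ t := not_lt.1 hy
  have hc : 0 < cπ * (εbar n / 3) ^ L := by positivity
  have hmass : ENNReal.ofReal (2⁻¹ * (cπ * (εbar n / 3) ^ L))
      ≤ acceptMass F model prior (m + ENNReal.ofReal (εbar n)) y := by
    rw [h3t]
    refine le_trans ?_ (acceptMass_ge hF hFb hn0 (hD_meas n) (hR_meas n) ht0
      ENNReal.ofReal_ne_top hhalf hy)
    rw [ENNReal.ofReal_mul (by norm_num), ENNReal.ofReal_inv_of_pos (by norm_num)]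
    simp only [ENNReal.ofReal_ofNat]
    gcongr
  refine ⟨(lt_of_lt_of_le (by simpa using hc) hmass).ne', ?_⟩
  have hrad0 : 0 ≤ radius F b L (εbar n) n := by unfold radius; positivity
  refine (abcPosterior_le (c := ENNReal.ofReal (εbar n ^ L / n)) fun θ hθ => ?_).trans ?_
  · have hlt : m + ENNReal.ofReal (radius F b L (εbar n) n) < ips F (model θ) μstar := by
      by_contra! h
      exact absurd (hdist _ hrad0 hr θ h) (not_le.2 hθ)
    rw [← exp_neg_sqrt_log hn1 hL hb h0 h1, ← ENNReal.ofReal_toReal hm_ne,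
      ← ENNReal.ofReal_add ENNReal.toReal_nonneg h0.le]
    -- The threshold contributes `ε̄` and the data fluctuation `ε̄/3`, which is the `4ε̄/3` of the
    -- radius; the term `2 R_n` is slack.
    refine acceptProb_le hF hb hFb hn0 (t := εbar n / 3) (by positivity) (by positivity)
      (Real.sqrt_nonneg _) ((ips_empirical_le_ghostDiscrepancy hF hFb hn0 _ _).trans hy)
      (lt_of_le_of_lt ?_ hlt)
    rw [← ENNReal.ofReal_toReal hm_ne, ← ENNReal.ofReal_add ENNReal.toReal_nonneg hrad0]
    refine ENNReal.ofReal_le_ofReal ?_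
    have : 0 ≤ (supRademacher F n).toReal := ENNReal.toReal_nonneg
    unfold radius
    simp only [ENNReal.toReal_ofReal ENNReal.toReal_nonneg]
    linarith
  · calc _ ≤ (ENNReal.ofReal (2⁻¹ * (cπ * (εbar n / 3) ^ L)))⁻¹
          * ENNReal.ofReal (εbar n ^ L / n) := by gcongr
      _ = ENNReal.ofReal (2 * 3 ^ L / (cπ * n)) := by
        rw [← ENNReal.ofReal_inv_of_pos (by positivity), ← ENNReal.ofReal_mul (by positivity),
          Real.div_rpow h0.le (by norm_num)]
        congr 1
        field_simp
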